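/- Let $q$ be a prime power, let $e_1\ge e_2\ge 1$ be integers and put $d=e_1+e_2$. Let $\Gamma$ be the bipartite graph whose vertex set is the disjoint union of the set of $e_1$-dimensional subspaces and the set of $e_2$-dimensional subspaces of $\mathbb{F}_q^{\,d}$ (two disjoint copies of the same set if $e_1=e_2$), where an $e_1$-subspace $S_1$ and an $e_2$-subspace $S_2$ are adjacent if and only if $S_1\cap S_2=\{0\}$, and there are no other edges. For $0\le j\le e_2$ let $$\lambda_j=q^{m_j},\qquad m_j=e_1e_2-\frac{j(d+1-j)}{2}.$$ Then $\lambda_0>\lambda_1>\cdots>\lambda_{e_2}>-\lambda_{e_2}>\cdots>-\lambda_1>-\lambda_0$, and these $2(e_2+1)$ numbers are precisely the distinct eigenvalues of the adjacency matrix of $\Gamma$. In particular, the largest eigenvalue of $\Gamma$ is $q^{e_1e_2}$, and its second largest distinct eigenvalue is $q^{e_1e_2-d/2}$. -/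

import Mathlib

namespace QKneser

/-- The `e`-subspaces of `F ^ d`. -/
def SubspaceOfDim (F : Type*) [Field F] (d e : ℕ) : Type _ :=
  {S : Submodule F (Fin d → F) // Module.finrank F S = e}

/-- The vertex set: the disjoint union of the `e₁`-subspaces and the `e₂`-subspaces of `F ^ d`
(two disjoint copies if `e₁ = e₂`). -/
abbrev Vertex (F : Type*) [Field F] (d e₁ e₂ : ℕ) : Type _ :=
  SubspaceOfDim F d e₁ ⊕ SubspaceOfDim F d e₂

instance instFiniteSubspaceOfDim (F : Type*) [Field F] [Finite F] (d e : ℕ) :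
    Finite (SubspaceOfDim F d e) :=
  inferInstanceAs (Finite {S : Submodule F (Fin d → F) // Module.finrank F S = e})

/-- The adjacency relation: vertices from different parts are adjacent when they intersect
trivially. -/
def Adj (F : Type*) [Field F] (d e₁ e₂ : ℕ) : Vertex F d e₁ e₂ → Vertex F d e₁ e₂ → Prop
  | Sum.inl S, Sum.inr T => S.1 ⊓ T.1 = ⊥
  | Sum.inr T, Sum.inl S => S.1 ⊓ T.1 = ⊥
  | _, _ => False

/-- The bipartite graph `Γ_{d,e₁,e₂}`. -/
def graph (F : Type*) [Field F] (d e₁ e₂ : ℕ) : SimpleGraph (Vertex F d e₁ e₂) where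
  Adj := Adj F d e₁ e₂
  symm := ⟨by
    rintro (S | S) (T | T) h
    · exact h
    · exact h
    · exact h
    · exact h⟩
  loopless := ⟨by
    rintro (S | S) h
    · exact h
    · exact h⟩

open Classical in
/-- The set of (distinct) eigenvalues of the adjacency matrix of a finite graph. That matrix is real
symmetric, so that all its eigenvalues are real. -/
noncomputable def eigenvalues {W : Type*} [Finite W] (G : SimpleGraph W) : Set ℝ :=
  letI := Fintype.ofFinite W
  {μ : ℝ | Module.End.HasEigenvalue (Matrix.toLin' (G.adjMatrix ℝ)) μ}

/-- The exponent `m_j = e₁ e₂ - j (d + 1 - j) / 2`, a (possibly half-integral) real number. -/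
noncomputable def m (d e₁ e₂ j : ℕ) : ℝ :=
  (e₁ : ℝ) * (e₂ : ℝ) - (j : ℝ) * ((d : ℝ) + 1 - (j : ℝ)) / 2

/-- `λ_j = q ^ m_j`. -/
noncomputable def ev (q d e₁ e₂ j : ℕ) : ℝ :=
  (q : ℝ) ^ (m d e₁ e₂ j)

end QKneser

/-! Let `N` be the bipartite adjacency operator on functions on `e₂`-subspaces. As the graph is
bipartite, its spectrum is governed by `NᵀN`. Filter the functions by the spans `U_j` of the
indicators of "`S` contains `A`" with `dim A < j`. Counting complements turns such an indicator into
`q ^ ((e - dim A) * e')` times that of "`T` avoids `A`" (`disjOp_restrictDim_above`). Modulo lower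
terms the latter is `(-1) ^ j * q ^ (j.choose 2)` times "contains `A`", where `j = dim A`
(`avoiding_sub_smul_above_mem`). So `NᵀN` acts on `U_{j+1} / U_j` as the scalar `λ_j ^ 2`
(`disjOp_disjOp_sub_mem`). Since `U_{e₂+1}` is everything, no other eigenvalue occurs; since the
filtration is strict (`lowSpanDim_lt_succ`), each one does. In particular `NᵀN` is invertible, so
`0` is not an eigenvalue of the graph. -/

namespace QKneser

/-! ### Counting complements of a subspace. -/

section Complements

variable {F V : Type*} [Field F] [AddCommGroup V] [Module F V]

/-- The complements of `T` that contain `A` form an affine space over the linear maps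
`V ⧸ (T ⊔ A) → T`; the base point is one such complement `S₀`. -/
noncomputable def complementEquiv {T A S₀ : Submodule F V} (h₀ : IsCompl T S₀) (hA : A ≤ S₀) :
    ((V ⧸ (T ⊔ A)) →ₗ[F] T) ≃ {S : Submodule F V // IsCompl T S ∧ A ≤ S} where
  -- A complement is encoded by the projection onto `T` along it. Two such projections agree on `T`
  -- and vanish on `A`, so their difference factors through `V ⧸ (T ⊔ A)`.
  toFun h := ⟨LinearMap.ker (T.projectionOnto S₀ h₀ + h ∘ₗ (T ⊔ A).mkQ), by
    refine ⟨LinearMap.isCompl_of_proj fun x => ?_, fun x hx => ?_⟩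
    · have : (T ⊔ A).mkQ (x : V) = 0 := by
        simpa using (le_sup_left : T ≤ T ⊔ A) x.2
      simp [LinearMap.comp_apply, this]
    · have : (T ⊔ A).mkQ x = 0 := by
        simpa using (le_sup_right : A ≤ T ⊔ A) hx
      have h2 : T.projectionOnto S₀ h₀ x = 0 := by
        simpa [Submodule.projectionOnto_apply_eq_zero_iff] using hA hx
      simp [LinearMap.comp_apply, this, h2]⟩
  invFun S := (T ⊔ A).liftQ (T.projectionOnto S.1 S.2.1 - T.projectionOnto S₀ h₀) (by
    refine sup_le (fun x hx => ?_) (fun x hx => ?_)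
    · have h1 := Submodule.projectionOnto_apply_left S.2.1 ⟨x, hx⟩
      have h2 := Submodule.projectionOnto_apply_left h₀ ⟨x, hx⟩
      simp only at h1 h2
      simp [h1, h2]
    · have h1 : T.projectionOnto S.1 S.2.1 x = 0 := by
        simpa [Submodule.projectionOnto_apply_eq_zero_iff] using S.2.2 hx
      have h2 : T.projectionOnto S₀ h₀ x = 0 := by
        simpa [Submodule.projectionOnto_apply_eq_zero_iff] using hA hx
      simp [h1, h2])
  left_inv h := by
    refine Submodule.linearMap_qext _ (LinearMap.ext fun x => ?_)
    have hp : ∀ x : T, (T.projectionOnto S₀ h₀ + h ∘ₗ (T ⊔ A).mkQ) x = x := fun x => by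
      have : (T ⊔ A).mkQ (x : V) = 0 := by
        simpa using (le_sup_left : T ≤ T ⊔ A) x.2
      simp [LinearMap.comp_apply, this]
    have := LinearMap.projectionOnto_of_proj _ hp
    simp [this]
  right_inv S := by
    apply Subtype.ext
    simp [Submodule.liftQ_mkQ]

theorem projectionOnto_complementEquiv {T A S₀ : Submodule F V} (h₀ : IsCompl T S₀) (hA : A ≤ S₀)
    (h : (V ⧸ (T ⊔ A)) →ₗ[F] T) :
    T.projectionOnto _ (complementEquiv h₀ hA h).2.1 =
      T.projectionOnto S₀ h₀ + h ∘ₗ (T ⊔ A).mkQ := by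
  refine LinearMap.projectionOnto_of_proj _ fun x => ?_
  have : (T ⊔ A).mkQ (x : V) = 0 := by
    simpa using (le_sup_left : T ≤ T ⊔ A) x.2
  simp [LinearMap.comp_apply, this]

theorem natCard_complements [Finite F] [FiniteDimensional F V] {T A : Submodule F V}
    (hTA : Disjoint A T) :
    Nat.card {S : Submodule F V // IsCompl T S ∧ A ≤ S} =
      Nat.card F ^ ((Module.finrank F V - Module.finrank F T - Module.finrank F A) *
        Module.finrank F T) := by
  obtain ⟨S₀, hA, h₀⟩ := hTA.exists_isCompl
  rw [← Nat.card_congr (complementEquiv h₀.symm hA), Module.natCard_eq_pow_finrank (K := F),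
    Module.finrank_linearMap]
  congr 2
  have h1 := (T ⊔ A).finrank_quotient_add_finrank
  have h2 := Submodule.finrank_sup_add_finrank_inf_eq T A
  rw [hTA.symm.eq_bot, finrank_bot] at h2
  omega

end Complements

/-! ### Avoidance in terms of containment, modulo lower dimension. -/

section Expansion

variable {F V : Type*} [Field F] [AddCommGroup V] [Module F V]

open Classical in
/-- The indicator function of the subspaces that contain `A`. -/
noncomputable def above (A : Submodule F V) : Submodule F V → ℝ :=
  fun S => if A ≤ S then 1 else 0

open Classical in
/-- The indicator function of the subspaces that meet `A` trivially. -/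
noncomputable def avoiding (A : Submodule F V) : Submodule F V → ℝ :=
  fun S => if A ⊓ S = ⊥ then 1 else 0

variable (F V) in
/-- The span of the functions `above A` over the subspaces `A` of dimension less than `j`. -/
def lowSpan (j : ℕ) : Submodule ℝ (Submodule F V → ℝ) :=
  Submodule.span ℝ {f | ∃ A : Submodule F V, Module.finrank F A < j ∧ f = above A}

theorem above_mem_lowSpan {j : ℕ} {A : Submodule F V} (hA : Module.finrank F A < j) :
    above A ∈ lowSpan F V j :=
  Submodule.subset_span ⟨A, hA, rfl⟩

theorem lowSpan_mono : Monotone (lowSpan F V) := fun _ _ hij =>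
  Submodule.span_mono fun _ ⟨A, hA, h⟩ => ⟨A, hA.trans_le hij, h⟩

theorem above_mul_above (A B : Submodule F V) : above A * above B = above (A ⊔ B) := by
  funext S
  simp only [above, Pi.mul_apply, sup_le_iff]
  split_ifs <;> simp_all

theorem above_mul_mem_lowSpan [FiniteDimensional F V] {j : ℕ} {L : Submodule F V}
    (hL : Module.finrank F L ≤ 1) {f : Submodule F V → ℝ} (hf : f ∈ lowSpan F V j) :
    above L * f ∈ lowSpan F V (j + 1) := by
  induction hf using Submodule.span_induction with
  | mem f hf =>
    obtain ⟨A, hA, rfl⟩ := hf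
    rw [above_mul_above]
    have := Submodule.finrank_add_le_finrank_add_finrank L A
    exact above_mem_lowSpan (by omega)
  | zero => simp
  | add f g _ _ hf hg => rw [mul_add]; exact add_mem hf hg
  | smul c f _ hf => rw [mul_smul_comm]; exact Submodule.smul_mem _ c hf

open Submodule in
-- If `S` avoids `A`, then `S` meets `A ⊔ span F {a}` in at most a line, and such a line contains
-- exactly one vector `a + x` with `x ∈ A`.
theorem avoiding_sup_span (A : Submodule F V) [Fintype A] {a : V}
    (ha : a ∉ A) :
    avoiding (A ⊔ span F {a}) =
      avoiding A - ∑ x : A, above (span F {a + (x : V)}) * avoiding A := by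
  classical
  funext S
  simp only [Pi.sub_apply, Finset.sum_apply, Pi.mul_apply, ← Finset.sum_mul]
  by_cases hAS : A ⊓ S = ⊥
  swap
  · have : (A ⊔ span F {a}) ⊓ S ≠ ⊥ := fun h =>
      hAS (eq_bot_iff.2 ((inf_le_inf_right S le_sup_left).trans h.le))
    simp [avoiding, hAS, this]
  have hA0 : ∀ y ∈ A, y ∈ S → y = 0 := fun y h1 h2 => by
    simpa [hAS] using mem_inf.2 ⟨h1, h2⟩
  by_cases h : (A ⊔ span F {a}) ⊓ S = ⊥
  · have hx : ∀ x : A, ¬ a + (x : V) ∈ S := fun x hx => by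
      have h1 : a + (x : V) ∈ (A ⊔ span F {a}) ⊓ S :=
        ⟨add_mem (mem_sup_right (mem_span_singleton_self a)) (mem_sup_left x.2), hx⟩
      rw [h, mem_bot] at h1
      exact ha ((eq_neg_of_add_eq_zero_left h1) ▸ neg_mem x.2)
    simp [avoiding, above, hAS, h, span_singleton_le_iff_mem, hx]
  · obtain ⟨s, ⟨hs1, hs2⟩, hs0⟩ := exists_mem_ne_zero_of_ne_bot h
    obtain ⟨y, hy, z, hz, rfl⟩ := mem_sup.1 hs1
    obtain ⟨c, rfl⟩ := mem_span_singleton.1 hz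
    have hc : c ≠ 0 := by
      rintro rfl
      simp only [zero_smul, add_zero] at hs0 hs2
      exact hs0 (hA0 y hy hs2)
    have hx0 : a + c⁻¹ • y ∈ S := by
      have := S.smul_mem c⁻¹ hs2
      rwa [smul_add, smul_smul, inv_mul_cancel₀ hc, one_smul, add_comm] at this
    have hiff : ∀ x : A, a + (x : V) ∈ S ↔ x = ⟨c⁻¹ • y, A.smul_mem _ hy⟩ := fun x => by
      refine ⟨fun hx => ?_, fun hx => hx ▸ hx0⟩
      have h1 := S.sub_mem hx hx0
      rw [add_sub_add_left_eq_sub] at h1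
      exact Subtype.ext (sub_eq_zero.1 (hA0 _ (A.sub_mem x.2 (A.smul_mem _ hy)) h1))
    simp [avoiding, above, hAS, h, span_singleton_le_iff_mem, hiff]

open Submodule in
theorem exists_eq_sup_span_singleton [FiniteDimensional F V] {A : Submodule F V} {j : ℕ}
    (hA : Module.finrank F A = j + 1) :
    ∃ (B : Submodule F V) (a : V), a ∉ B ∧ A = B ⊔ span F {a} ∧ Module.finrank F B = j := by
  have hne : A ≠ ⊥ := by
    rintro rfl
    simp at hA
  obtain ⟨a, haA, ha0⟩ := exists_mem_ne_zero_of_ne_bot hne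
  have hle : span F {a} ≤ A := (span_singleton_le_iff_mem a A).2 haA
  obtain ⟨U, hU⟩ := Submodule.exists_isCompl (span F {a})
  have hsup : A = U ⊓ A ⊔ span F {a} := by
    rw [sup_comm, ← sup_inf_assoc_of_le U hle, hU.sup_eq_top, top_inf_eq]
  have hinf : (U ⊓ A) ⊓ span F {a} = ⊥ :=
    eq_bot_iff.2 ((inf_le_inf_right _ inf_le_left).trans hU.symm.inf_eq_bot.le)
  refine ⟨U ⊓ A, a, fun h => ha0 ?_, hsup, ?_⟩
  · simpa [hinf] using mem_inf.2 ⟨h, mem_span_singleton_self (R := F) a⟩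
  · have h := finrank_sup_add_finrank_inf_eq (U ⊓ A) (span F {a})
    rw [← hsup, hinf, finrank_bot, hA, finrank_span_singleton ha0] at h
    omega

/-- Modulo the functions `above B` with `dim B < j`, the indicator function of avoiding a
`j`-dimensional `A` is a multiple of that of containing `A`. -/
theorem avoiding_sub_smul_above_mem [Finite F] [FiniteDimensional F V] (j : ℕ)
    (A : Submodule F V) (hA : Module.finrank F A = j) :
    avoiding A - ((-1 : ℝ) ^ j * (Nat.card F : ℝ) ^ (j.choose 2)) • above A ∈ lowSpan F V j := by
  classical
  have : Finite V := Module.finite_of_finite F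
  induction j generalizing A with
  | zero =>
    have h0 : A = ⊥ := Submodule.finrank_eq_zero.1 hA
    have : avoiding A - above A = 0 := by
      funext S
      simp [avoiding, above, h0]
    simp [this]
  | succ j ih =>
    obtain ⟨B, a, ha, rfl, hB⟩ := exists_eq_sup_span_singleton hA
    have : Fintype B := Fintype.ofFinite B
    have hcard : (Fintype.card B : ℝ) = (Nat.card F : ℝ) ^ j := by
      rw [← Nat.card_eq_fintype_card, Module.natCard_eq_pow_finrank (K := F), hB, Nat.cast_pow]
    set c : ℝ := (-1) ^ j * (Nat.card F : ℝ) ^ (j.choose 2) with hc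
    set r := avoiding B - c • above B with hr
    have hrm : r ∈ lowSpan F V j := ih B hB
    have hBr : avoiding B = c • above B + r := by rw [hr]; abel
    have hBm : avoiding B ∈ lowSpan F V (j + 1) := by
      rw [hBr]
      exact add_mem (Submodule.smul_mem _ _ (above_mem_lowSpan (by omega)))
        (lowSpan_mono (Nat.le_succ j) hrm)
    -- All `q ^ j` lines have the same join with `B`, so the leading terms add up; this gives the
    -- factor `-q ^ j` from one dimension to the next.
    have hsup : ∀ x : B, Submodule.span F {a + (x : V)} ⊔ B = B ⊔ Submodule.span F {a} := by
      intro x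
      rw [sup_comm]
      refine le_antisymm (sup_le le_sup_left ?_) (sup_le le_sup_left ?_) <;>
        rw [Submodule.span_singleton_le_iff_mem]
      · exact add_mem (Submodule.mem_sup_right (Submodule.mem_span_singleton_self a))
          (Submodule.mem_sup_left x.2)
      · have h1 := sub_mem (Submodule.mem_sup_right (S := B)
          (Submodule.mem_span_singleton_self (R := F) (a + (x : V)))) (Submodule.mem_sup_left x.2)
        rwa [add_sub_cancel_right] at h1
    have hterm : ∀ x : B, above (Submodule.span F {a + (x : V)}) * avoiding B =
        c • above (B ⊔ Submodule.span F {a}) + above (Submodule.span F {a + (x : V)}) * r := by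
      intro x
      rw [hBr, mul_add, mul_smul_comm, above_mul_above, hsup x]
    rw [avoiding_sup_span B ha, Finset.sum_congr rfl fun x _ => hterm x, Finset.sum_add_distrib,
      Finset.sum_const, Finset.card_univ, ← Nat.cast_smul_eq_nsmul ℝ, hcard, smul_smul]
    have hcoef : (-1 : ℝ) ^ (j + 1) * (Nat.card F : ℝ) ^ ((j + 1).choose 2) =
        -((Nat.card F : ℝ) ^ j * c) := by
      rw [hc, Nat.choose_succ_succ' j 1, Nat.choose_one_right, pow_add, pow_succ]
      ring
    rw [hcoef, neg_smul]
    have hsum : ∑ x : B, above (Submodule.span F {a + (x : V)}) * r ∈ lowSpan F V (j + 1) :=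
      sum_mem fun x _ => above_mul_mem_lowSpan (finrank_span_le_card _ |>.trans (by simp)) hrm
    convert sub_mem hBm hsum using 1
    abel

end Expansion

/-! ### The adjacency operator is triangular for the filtration. -/

section Operator

variable {F : Type*} [Field F] {d : ℕ}

variable (F d) in
/-- Restriction of functions on all subspaces to the `e`-subspaces. -/
def restrictDim (e : ℕ) :
    (Submodule F (Fin d → F) → ℝ) →ₗ[ℝ] (SubspaceOfDim F d e → ℝ) :=
  LinearMap.funLeft ℝ ℝ (fun S : SubspaceOfDim F d e => S.1)

theorem restrictDim_apply (e : ℕ) (f : Submodule F (Fin d → F) → ℝ) (S : SubspaceOfDim F d e) :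
    restrictDim F d e f S = f S.1 := rfl

theorem isCompl_iff {e e' : ℕ} (hd : d = e + e') {S T : Submodule F (Fin d → F)}
    (hT : Module.finrank F T = e') :
    IsCompl T S ↔ Module.finrank F S = e ∧ S ⊓ T = ⊥ := by
  have hV : Module.finrank F (Fin d → F) = d := by simp
  constructor
  · intro h
    have := Submodule.finrank_add_eq_of_isCompl h
    exact ⟨by omega, h.symm.inf_eq_bot⟩
  · rintro ⟨h1, h2⟩
    refine IsCompl.symm ⟨disjoint_iff.2 h2, codisjoint_iff.2 ?_⟩
    have := Submodule.finrank_sup_add_finrank_inf_eq S T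
    rw [h2, finrank_bot] at this
    exact Submodule.eq_top_of_finrank_eq (by omega)

/-- The `e`-subspaces that contain `A` and are disjoint from `T` are the complements of `T` that
contain `A`. -/
def disjointEquivComplements {e e' : ℕ} (hd : d = e + e') {T : Submodule F (Fin d → F)}
    (hT : Module.finrank F T = e') (A : Submodule F (Fin d → F)) :
    {S : SubspaceOfDim F d e // S.1 ⊓ T = ⊥ ∧ A ≤ S.1} ≃
      {S : Submodule F (Fin d → F) // IsCompl T S ∧ A ≤ S} where
  toFun S := ⟨S.1.1, (isCompl_iff hd hT).2 ⟨S.1.2, S.2.1⟩, S.2.2⟩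
  invFun S := ⟨⟨S.1, ((isCompl_iff hd hT).1 S.2.1).1⟩, ((isCompl_iff hd hT).1 S.2.1).2, S.2.2⟩
  left_inv _ := rfl
  right_inv _ := rfl

variable (F d) in
/-- The restrictions to the `e`-subspaces of the functions in `lowSpan j`. -/
def lowSpanDim (e j : ℕ) : Submodule ℝ (SubspaceOfDim F d e → ℝ) :=
  (lowSpan F (Fin d → F) j).map (restrictDim F d e)

theorem lowSpanDim_mono (e : ℕ) : Monotone (lowSpanDim F d e) := fun _ _ h =>
  Submodule.map_mono (lowSpan_mono h)

theorem restrictDim_above_mem {e j : ℕ} {A : Submodule F (Fin d → F)}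
    (hA : Module.finrank F A < j) : restrictDim F d e (above A) ∈ lowSpanDim F d e j :=
  Submodule.mem_map_of_mem (above_mem_lowSpan hA)

theorem lowSpanDim_induction {e j : ℕ} (P : (SubspaceOfDim F d e → ℝ) → Prop)
    (habove : ∀ A : Submodule F (Fin d → F), Module.finrank F A < j →
      P (restrictDim F d e (above A)))
    (hzero : P 0) (hadd : ∀ f g, P f → P g → P (f + g)) (hsmul : ∀ (c : ℝ) f, P f → P (c • f))
    {f : SubspaceOfDim F d e → ℝ} (hf : f ∈ lowSpanDim F d e j) : P f := by
  obtain ⟨f, hf, rfl⟩ := hf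
  induction hf using Submodule.span_induction with
  | mem f hf =>
    obtain ⟨A, hA, rfl⟩ := hf
    exact habove A hA
  | zero => simpa using hzero
  | add f g _ _ hf hg => rw [map_add]; exact hadd _ _ hf hg
  | smul c f _ hf => rw [map_smul]; exact hsmul _ _ hf

theorem lowSpanDim_zero (e : ℕ) : lowSpanDim F d e 0 = ⊥ :=
  eq_bot_iff.2 fun _ hf => lowSpanDim_induction (· ∈ (⊥ : Submodule ℝ _))
    (fun _ hA => absurd hA (Nat.not_lt_zero _)) (zero_mem _) (fun _ _ => add_mem)
    (fun c _ => Submodule.smul_mem _ c) hf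

variable [Finite F]

noncomputable instance instFintypeSubspaceOfDim (F : Type*) [Field F] [Finite F] (d e : ℕ) :
    Fintype (SubspaceOfDim F d e) :=
  Fintype.ofFinite _

variable (F d) in
open Classical in
/-- The bipartite adjacency operator from functions on `e`-subspaces to functions on
`e'`-subspaces. -/
noncomputable def disjOp (e e' : ℕ) :
    (SubspaceOfDim F d e → ℝ) →ₗ[ℝ] (SubspaceOfDim F d e' → ℝ) where
  toFun f T := ∑ S, if S.1 ⊓ T.1 = ⊥ then f S else 0
  map_add' f g := by
    funext T
    simp only [Pi.add_apply, ← Finset.sum_add_distrib]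
    exact Finset.sum_congr rfl fun S _ => by split_ifs <;> simp
  map_smul' c f := by
    funext T
    simp only [Pi.smul_apply, smul_eq_mul, RingHom.id_apply, Finset.mul_sum]
    exact Finset.sum_congr rfl fun S _ => by split_ifs <;> simp

open Classical in
theorem disjOp_apply (e e' : ℕ) (f : SubspaceOfDim F d e → ℝ) (T : SubspaceOfDim F d e') :
    disjOp F d e e' f T = ∑ S : SubspaceOfDim F d e, if S.1 ⊓ T.1 = ⊥ then f S else 0 := rfl

/-- If `T` avoids `A`, the sum counts the complements of `T` above `A`; otherwise there are none.
Truncation in `e - finrank A` is harmless: if some `T` avoids `A`, then `dim A ≤ e`. -/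
theorem disjOp_restrictDim_above {e e' : ℕ} (hd : d = e + e') (A : Submodule F (Fin d → F)) :
    disjOp F d e e' (restrictDim F d e (above A)) =
      (Nat.card F : ℝ) ^ ((e - Module.finrank F A) * e') •
        restrictDim F d e' (avoiding A) := by
  classical
  funext T
  simp only [disjOp_apply, restrictDim_apply, Pi.smul_apply, above, avoiding, ← ite_and,
    Finset.sum_boole, smul_eq_mul]
  split_ifs with h
  · have := natCard_complements (disjoint_iff.2 h)
    rw [← Nat.card_congr (disjointEquivComplements hd T.2 A), T.2, Module.finrank_fin_fun,
      Nat.card_eq_fintype_card, Fintype.card_subtype] at this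
    rw [this, mul_one, Nat.cast_pow, show d - e' = e by omega]
  · rw [mul_zero, Nat.cast_eq_zero, Finset.card_eq_zero, Finset.filter_eq_empty_iff]
    rintro S - ⟨h1, h2⟩
    exact h (eq_bot_iff.2 ((inf_le_inf_right _ h2).trans h1.le))

/-- Among `e`-subspaces, only `S` itself contains `S`, so point indicators belong to the span. -/
theorem lowSpanDim_succ_self (e : ℕ) : lowSpanDim F d e (e + 1) = ⊤ := by
  classical
  refine eq_top_iff.2 fun f _ => ?_
  have hf : f = ∑ S : SubspaceOfDim F d e, f S • restrictDim F d e (above S.1) := by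
    funext T
    have hST : ∀ S : SubspaceOfDim F d e, S.1 ≤ T.1 ↔ S = T := fun S =>
      ⟨fun h => Subtype.ext (Submodule.eq_of_le_of_finrank_eq h (S.2.trans T.2.symm)),
        fun h => h ▸ le_rfl⟩
    simp [restrictDim_apply, above, hST]
  rw [hf]
  exact sum_mem fun S _ => Submodule.smul_mem _ _
    (restrictDim_above_mem (Nat.lt_succ_of_le S.2.le))

/-- The diagonal entries of `disjOp` with respect to the filtrations `lowSpanDim`. -/
noncomputable def diagCoeff (q e e' j : ℕ) : ℝ :=
  (q : ℝ) ^ ((e - j) * e') * ((-1 : ℝ) ^ j * (q : ℝ) ^ (j.choose 2))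

theorem disjOp_above_sub_mem {e e' : ℕ} (hd : d = e + e') (A : Submodule F (Fin d → F)) :
    disjOp F d e e' (restrictDim F d e (above A)) -
      diagCoeff (Nat.card F) e e' (Module.finrank F A) • restrictDim F d e' (above A) ∈
        lowSpanDim F d e' (Module.finrank F A) := by
  rw [disjOp_restrictDim_above hd, diagCoeff, mul_smul, ← smul_sub, ← map_smul, ← map_sub]
  exact Submodule.smul_mem _ _
    (Submodule.mem_map_of_mem (avoiding_sub_smul_above_mem _ A rfl))

theorem disjOp_mem {e e' j : ℕ} (hd : d = e + e') {f : SubspaceOfDim F d e → ℝ}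
    (hf : f ∈ lowSpanDim F d e j) : disjOp F d e e' f ∈ lowSpanDim F d e' j := by
  refine lowSpanDim_induction (fun f => disjOp F d e e' f ∈ lowSpanDim F d e' j)
    (fun A hA => ?_) (by simp) (fun f g hf hg => ?_) (fun c f hf => ?_) hf
  · have h := lowSpanDim_mono e' hA.le (disjOp_above_sub_mem hd A)
    simpa using add_mem h (Submodule.smul_mem _ (diagCoeff (Nat.card F) e e' (Module.finrank F A))
      (restrictDim_above_mem (e := e') hA))
  · rw [map_add]; exact add_mem hf hg
  · rw [map_smul]; exact Submodule.smul_mem _ c hf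

/-- The composite of `disjOp` with its transpose is triangular with respect to the filtration
`lowSpanDim`. -/
theorem disjOp_disjOp_sub_mem {e e' j : ℕ} (hd : d = e + e') {f : SubspaceOfDim F d e → ℝ}
    (hf : f ∈ lowSpanDim F d e (j + 1)) :
    disjOp F d e' e (disjOp F d e e' f) -
      (diagCoeff (Nat.card F) e e' j * diagCoeff (Nat.card F) e' e j) • f ∈
        lowSpanDim F d e j := by
  have hd' : d = e' + e := by omega
  refine lowSpanDim_induction (fun f => disjOp F d e' e (disjOp F d e e' f) -
      (diagCoeff (Nat.card F) e e' j * diagCoeff (Nat.card F) e' e j) • f ∈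
        lowSpanDim F d e j) (fun A hA => ?_) (by simp) (fun f g hf hg => ?_) (fun c f hf => ?_) hf
  · rcases Nat.lt_succ_iff_lt_or_eq.1 hA with hA | rfl
    · have h := restrictDim_above_mem (e := e) hA
      exact sub_mem (disjOp_mem hd' (disjOp_mem hd h)) (Submodule.smul_mem _ _ h)
    · have h1 := disjOp_mem hd' (disjOp_above_sub_mem hd A)
      have h2 := Submodule.smul_mem _ (diagCoeff (Nat.card F) e e' (Module.finrank F A))
        (disjOp_above_sub_mem hd' A)
      have h3 := add_mem h1 h2
      rwa [map_sub, map_smul, smul_sub, smul_smul, sub_add_sub_cancel] at h3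
  · rw [map_add, map_add, smul_add, add_sub_add_comm]; exact add_mem hf hg
  · rw [map_smul, map_smul, smul_comm, ← smul_sub]; exact Submodule.smul_mem _ c hf

end Operator

/-! ### Strictness of the filtration. -/

section Strict

/-- Average over the translations by `t • u`: for each `h` the argument then runs through all of
`F`. -/
theorem sum_translate_eq_zero {F H : Type*} [Field F] [Fintype F] [AddCommGroup H] [Module F H]
    [Fintype H] (φ : F → ℝ) (hφ : ∑ x, φ x = 0) (L : H →ₗ[F] F) {u : H} (hu : L u = 1) (c : F) :
    ∑ h, φ (c + L h) = 0 := by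
  have h1 : ∀ t : F, ∑ h, φ (c + L h) = ∑ h, φ (c + L h + t) := fun t =>
    (Fintype.sum_equiv (Equiv.addRight (t • u)) _ _ fun h => by simp [hu, add_assoc]).symm
  have h2 : ∀ x : F, ∑ t, φ (x + t) = 0 := fun x =>
    (Fintype.sum_equiv (Equiv.addLeft x) _ φ fun _ => rfl).trans hφ
  have h3 : (Fintype.card F : ℝ) * ∑ h, φ (c + L h) = 0 := by
    rw [← nsmul_eq_mul, ← Finset.card_univ, ← Finset.sum_const, Finset.sum_congr rfl fun t _ => h1 t,
      Finset.sum_comm]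
    exact Finset.sum_eq_zero fun h _ => h2 _
  exact (mul_eq_zero.1 h3).resolve_left (Nat.cast_ne_zero.2 Fintype.card_ne_zero)

variable {F : Type*} [Field F] [Finite F] {d : ℕ}

open Classical in
/-- The function on `e`-subspaces that is `G` of the projection onto `T` along `S` when `S` is a
complement of `T`, and zero otherwise. -/
noncomputable def projFun (e : ℕ) (T : Submodule F (Fin d → F)) (G : ((Fin d → F) →ₗ[F] T) → ℝ)
    (S : SubspaceOfDim F d e) : ℝ :=
  if h : IsCompl T S.1 then G (T.projectionOnto S.1 h) else 0

theorem projFun_dotProduct_above {e e' : ℕ} (hd : d = e + e') {T S₀ B : Submodule F (Fin d → F)}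
    (hT : Module.finrank F T = e') (h₀ : IsCompl T S₀) (hB : B ≤ S₀)
    [Fintype (((Fin d → F) ⧸ (T ⊔ B)) →ₗ[F] T)] (G : ((Fin d → F) →ₗ[F] T) → ℝ) :
    projFun e T G ⬝ᵥ restrictDim F d e (above B) =
      ∑ h : ((Fin d → F) ⧸ (T ⊔ B)) →ₗ[F] T, G (T.projectionOnto S₀ h₀ + h ∘ₗ (T ⊔ B).mkQ) := by
  classical
  refine (Finset.sum_of_injOn (fun h => ((disjointEquivComplements hd hT B).symm
    (complementEquiv h₀ hB h)).1) ?_ (fun _ _ => Finset.mem_coe.2 (Finset.mem_univ _)) ?_ ?_).symm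
  · exact (Subtype.val_injective.comp ((disjointEquivComplements hd hT B).symm.injective.comp
      (complementEquiv h₀ hB).injective)).injOn
  · intro S _ hS
    by_cases h : IsCompl T S.1 ∧ B ≤ S.1
    · refine absurd ⟨(complementEquiv h₀ hB).symm ⟨S.1, h⟩, by simp, ?_⟩ hS
      exact congrArg (fun x => ((disjointEquivComplements hd hT B).symm x).1)
        (Equiv.apply_symm_apply _ _)
    · rcases not_and_or.1 h with h | h
      · simp [projFun, h]
      · simp [restrictDim_apply, above, h]
  · intro h _
    have h1 := (complementEquiv h₀ hB h).2.1
    have h2 := (complementEquiv h₀ hB h).2.2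
    have h3 := projectionOnto_complementEquiv h₀ hB h
    have h4 : projFun e T G ((disjointEquivComplements hd hT B).symm (complementEquiv h₀ hB h)).1 =
        G (T.projectionOnto _ h1) := dif_pos h1
    have h5 : restrictDim F d e (above B)
        ((disjointEquivComplements hd hT B).symm (complementEquiv h₀ hB h)).1 = 1 := if_pos h2
    rw [h4, h5, h3, mul_one]

theorem projFun_dotProduct_above_of_not_disjoint {e : ℕ} {T B : Submodule F (Fin d → F)}
    (hB : ¬ Disjoint B T) (G : ((Fin d → F) →ₗ[F] T) → ℝ) :
    projFun e T G ⬝ᵥ restrictDim F d e (above B) = 0 := by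
  classical
  refine Finset.sum_eq_zero fun S _ => ?_
  by_cases h : IsCompl T S.1
  · have : ¬ B ≤ S.1 := fun h1 => hB (h.disjoint.symm.mono_left h1)
    simp [restrictDim_apply, above, this]
  · simp [projFun, h]

/-- A function supported on the complements of a fixed `T` is orthogonal to the lower span, but not
to `above A` for one `A` of dimension `j`. -/
theorem lowSpanDim_lt_succ {e e' j : ℕ} (hd : d = e + e') (hje : j ≤ e) (hje' : j ≤ e') :
    lowSpanDim F d e j < lowSpanDim F d e (j + 1) := by
  classical
  have : Fintype F := Fintype.ofFinite F
  let b : Module.Basis (Fin e ⊕ Fin e') F (Fin d → F) :=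
    (Module.finBasisOfFinrankEq F (Fin d → F) (by simpa using hd)).reindex finSumFinEquiv.symm
  let κ : Fin j → Fin e ⊕ Fin e' := Sum.inl ∘ Fin.castLE hje
  let T : Submodule F (Fin d → F) := Submodule.span F (b '' Set.range Sum.inr)
  let A : Submodule F (Fin d → F) := Submodule.span F (b '' Set.range κ)
  have hbT : ∀ i, b (Sum.inr i) ∈ T := fun i => Submodule.subset_span ⟨_, ⟨i, rfl⟩, rfl⟩
  have hbA : ∀ l, b (κ l) ∈ A := fun l => Submodule.subset_span ⟨_, ⟨l, rfl⟩, rfl⟩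
  have hκ : Function.Injective κ := Sum.inl_injective.comp (Fin.castLE_injective hje)
  have hT : Module.finrank F T = e' := by
    have := finrank_span_eq_card (b.linearIndependent.comp _ Sum.inr_injective)
    rwa [Set.range_comp, Fintype.card_fin] at this
  have hA : Module.finrank F A = j := by
    have := finrank_span_eq_card (b.linearIndependent.comp _ hκ)
    rwa [Set.range_comp, Fintype.card_fin] at this
  have hAT : Disjoint A T := by
    refine b.linearIndependent.disjoint_span_image ?_
    rw [Set.disjoint_left]
    rintro _ ⟨l, rfl⟩ ⟨i, hi⟩
    simp [κ] at hi
  -- A trace pairing of rank `j`: it cannot vanish on all maps that kill `T ⊔ B` when `dim B < j`,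
  -- but it does vanish on all maps that kill `A`.
  let L : ((Fin d → F) →ₗ[F] T) →ₗ[F] F :=
    ∑ l : Fin j, (b.coord (Sum.inr (Fin.castLE hje' l)) ∘ₗ T.subtype) ∘ₗ
      LinearMap.applyₗ (b (κ l))
  have hL : ∀ f, L f = ∑ l : Fin j, b.coord (Sum.inr (Fin.castLE hje' l)) (f (b (κ l))) := by
    intro f
    simp [L, LinearMap.sum_apply]
  -- A real stand-in for a nontrivial additive character: zero sum, nonzero at `0`.
  let φ : F → ℝ := fun x => (if x = 0 then (Fintype.card F : ℝ) else 0) - 1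
  have hφ : ∑ x, φ x = 0 := by simp [φ]
  have hφ0 : 0 < φ 0 := by
    have : (1 : ℝ) < Fintype.card F := Nat.one_lt_cast.2 Fintype.one_lt_card
    simpa [φ] using this
  refine lt_of_le_of_ne (lowSpanDim_mono e (Nat.le_succ j)) fun heq => ?_
  have hzero : ∀ f ∈ lowSpanDim F d e j, projFun e T (fun f => φ (L f)) ⬝ᵥ f = 0 := by
    intro f hf
    refine lowSpanDim_induction (fun f => projFun e T (fun f => φ (L f)) ⬝ᵥ f = 0)
      (fun B hB => ?_) (by simp) (fun f g hf hg => ?_) (fun c f hf => ?_) hf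
    · by_cases hBT : Disjoint B T
      swap
      · exact projFun_dotProduct_above_of_not_disjoint hBT _
      obtain ⟨S₀, hBS, hS₀⟩ := hBT.exists_isCompl
      have : Finite (((Fin d → F) ⧸ (T ⊔ B)) →ₗ[F] T) := Module.finite_of_finite F
      have := Fintype.ofFinite (((Fin d → F) ⧸ (T ⊔ B)) →ₗ[F] T)
      rw [projFun_dotProduct_above hd hT hS₀.symm hBS]
      have hex : ∃ i, b (κ i) ∉ T ⊔ B := by
        by_contra! hall
        have hle : A ⊔ T ≤ T ⊔ B := by
          refine sup_le (Submodule.span_le.2 ?_) le_sup_left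
          rintro _ ⟨_, ⟨l, rfl⟩, rfl⟩
          exact hall l
        have h1 := Submodule.finrank_mono hle
        have h2 := Submodule.finrank_add_le_finrank_add_finrank T B
        have h3 := Submodule.finrank_sup_add_finrank_inf_eq A T
        rw [hAT.eq_bot, finrank_bot] at h3
        omega
      obtain ⟨i, hi⟩ := hex
      obtain ⟨ξ, hξ⟩ : ∃ ξ : Module.Dual F ((Fin d → F) ⧸ (T ⊔ B)),
          ξ ((T ⊔ B).mkQ (b (κ i))) = 1 := by
        have hne : (T ⊔ B).mkQ (b (κ i)) ≠ 0 := by simpa using hi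
        exact Module.Projective.exists_dual_eq_one F hne
      let L' : (((Fin d → F) ⧸ (T ⊔ B)) →ₗ[F] T) →ₗ[F] F := L ∘ₗ LinearMap.lcomp F T (T ⊔ B).mkQ
      -- In this rank-one map only the `i`-th summand of `L` survives, whatever `ξ` does to the
      -- other `b (κ l)`.
      have hu : L' (ξ.smulRight ⟨b (Sum.inr (Fin.castLE hje' i)), hbT _⟩) = 1 := by
        simp only [L', LinearMap.comp_apply, hL, LinearMap.lcomp_apply']
        rw [Finset.sum_eq_single i]
        · simp only [LinearMap.smulRight_apply, hξ]
          simp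
        · intro l _ hl
          simp [hl.symm]
        · simp
      have := sum_translate_eq_zero (H := ((Fin d → F) ⧸ (T ⊔ B)) →ₗ[F] T) φ hφ L' (by exact hu) (L (T.projectionOnto S₀ hS₀.symm))
      rw [← this]
      refine Finset.sum_congr rfl fun h _ => ?_
      rw [map_add]
      rfl
    · rw [dotProduct_add, hf, hg, add_zero]
    · rw [dotProduct_smul, hf, smul_zero]
  have h := hzero _ (heq ▸ restrictDim_above_mem (e := e) (hA.trans_lt (Nat.lt_succ_self j)))
  obtain ⟨S₀, hAS, hS₀⟩ := hAT.exists_isCompl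
  have : Finite (((Fin d → F) ⧸ (T ⊔ A)) →ₗ[F] T) := Module.finite_of_finite F
  have := Fintype.ofFinite (((Fin d → F) ⧸ (T ⊔ A)) →ₗ[F] T)
  rw [projFun_dotProduct_above hd hT hS₀.symm hAS] at h
  have hval : ∀ f : ((Fin d → F) ⧸ (T ⊔ A)) →ₗ[F] T,
      L (T.projectionOnto S₀ hS₀.symm + f ∘ₗ (T ⊔ A).mkQ) = 0 := by
    intro f
    rw [hL]
    refine Finset.sum_eq_zero fun l _ => ?_
    have h1 : T.projectionOnto S₀ hS₀.symm (b (κ l)) = 0 :=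
      (Submodule.projectionOnto_apply_eq_zero_iff _).2 (hAS (hbA l))
    have h2 : (T ⊔ A).mkQ (b (κ l)) = 0 := by
      simpa using (le_sup_right : A ≤ T ⊔ A) (hbA l)
    rw [LinearMap.add_apply, LinearMap.comp_apply, h1, h2, map_zero, add_zero,
      ZeroMemClass.coe_zero, map_zero]
  simp only [hval, Finset.sum_const, Finset.card_univ, nsmul_eq_mul] at h
  exact mul_ne_zero (Nat.cast_ne_zero.2 Fintype.card_ne_zero) hφ0.ne' h

end Strict

/-! ### From the triangular form to the spectrum of the graph. -/

section Spectrum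

theorem ev_pos {q d e₁ e₂ j : ℕ} (hq : 0 < q) : 0 < ev q d e₁ e₂ j :=
  Real.rpow_pos_of_pos (Nat.cast_pos.2 hq) _

theorem ev_lt_ev {q d e₁ e₂ i j : ℕ} (hq : 1 < q) (hij : i < j) (hj : 2 * j ≤ d) :
    ev q d e₁ e₂ j < ev q d e₁ e₂ i := by
  refine Real.rpow_lt_rpow_of_exponent_lt (Nat.one_lt_cast.2 hq) ?_
  have h1 : (i : ℝ) + 1 ≤ j := by exact_mod_cast hij
  have h2 : 2 * (j : ℝ) ≤ d := by exact_mod_cast hj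
  simp only [m]
  -- Here `m_i - m_j = (j - i) * (d + 1 - i - j) / 2`, and `i + j < d`.
  nlinarith

theorem diagCoeff_mul_diagCoeff {q e₁ e₂ j : ℕ} (h₁ : j ≤ e₁) (h₂ : j ≤ e₂) :
    diagCoeff q e₂ e₁ j * diagCoeff q e₁ e₂ j = ev q (e₁ + e₂) e₁ e₂ j ^ 2 := by
  have hsign : ((-1 : ℝ) ^ j) * (-1) ^ j = 1 := by rw [← mul_pow]; simp
  have hl : diagCoeff q e₂ e₁ j * diagCoeff q e₁ e₂ j =
      (q : ℝ) ^ ((e₂ - j) * e₁ + (e₁ - j) * e₂ + 2 * j.choose 2) := by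
    rw [diagCoeff, diagCoeff, pow_add, pow_add, two_mul, pow_add]
    linear_combination ((q : ℝ) ^ ((e₂ - j) * e₁) * (q : ℝ) ^ ((e₁ - j) * e₂) *
      ((q : ℝ) ^ j.choose 2 * (q : ℝ) ^ j.choose 2)) * hsign
  rw [hl, ev, ← Real.rpow_natCast, ← Real.rpow_natCast, ← Real.rpow_mul (Nat.cast_nonneg q)]
  congr 1
  push_cast [m, Nat.cast_sub h₁, Nat.cast_sub h₂, Nat.cast_choose_two]
  ring

variable {F : Type*} [Field F] [Finite F] {d : ℕ}

theorem toLin'_adjMatrix (e₁ e₂ : ℕ) {hfin : Fintype (Vertex F d e₁ e₂)}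
    {_ : DecidableEq (Vertex F d e₁ e₂)} {_ : DecidableRel (graph F d e₁ e₂).Adj}
    (v : Vertex F d e₁ e₂ → ℝ) :
    Matrix.toLin' ((graph F d e₁ e₂).adjMatrix ℝ) v =
      Sum.elim (disjOp F d e₂ e₁ (v ∘ Sum.inr)) (disjOp F d e₁ e₂ (v ∘ Sum.inl)) := by
  classical
  -- `eigenvalues` uses `Fintype.ofFinite`, whereas splitting the sum needs the instance of a sum
  -- type.
  obtain rfl : hfin = instFintypeSum _ _ := Subsingleton.elim _ _
  funext x
  rw [Matrix.toLin'_apply, Matrix.mulVec, dotProduct, Fintype.sum_sum_type]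
  rcases x with S | T
  · simp only [SimpleGraph.adjMatrix_apply, ite_mul, one_mul, zero_mul, Sum.elim_inl, disjOp_apply,
      Function.comp_apply]
    rw [Finset.sum_eq_zero, zero_add]
    · refine Finset.sum_congr rfl fun T _ => if_congr ?_ rfl rfl
      rw [inf_comm]
      rfl
    · exact fun T _ => if_neg id
  · simp only [SimpleGraph.adjMatrix_apply, ite_mul, one_mul, zero_mul, Sum.elim_inr, disjOp_apply,
      Function.comp_apply]
    rw [add_eq_left.2 (Finset.sum_eq_zero _)]
    · exact Finset.sum_congr rfl fun S _ => if_congr Iff.rfl rfl rfl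
    · exact fun T _ => if_neg id

theorem mem_eigenvalues_graph_iff {e₁ e₂ : ℕ} {μ : ℝ} :
    μ ∈ eigenvalues (graph F d e₁ e₂) ↔
      ∃ (f : SubspaceOfDim F d e₁ → ℝ) (g : SubspaceOfDim F d e₂ → ℝ), (f ≠ 0 ∨ g ≠ 0) ∧
        disjOp F d e₂ e₁ g = μ • f ∧ disjOp F d e₁ e₂ f = μ • g := by
  constructor
  · intro h
    obtain ⟨v, hv⟩ := Module.End.HasEigenvalue.exists_hasEigenvector h
    have h1 := (toLin'_adjMatrix e₁ e₂ v).symm.trans (Module.End.mem_eigenspace_iff.1 hv.1)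
    refine ⟨v ∘ Sum.inl, v ∘ Sum.inr, ?_, ?_, ?_⟩
    · by_contra! hcon
      refine hv.2 (funext fun x => ?_)
      rcases x with S | T
      · exact congrFun hcon.1 S
      · exact congrFun hcon.2 T
    · exact funext fun S => congrFun h1 (Sum.inl S)
    · exact funext fun T => congrFun h1 (Sum.inr T)
  · rintro ⟨f, g, hne, hf, hg⟩
    refine Module.End.hasEigenvalue_of_hasEigenvector (x := Sum.elim f g)
      ⟨Module.End.mem_eigenspace_iff.2 ((toLin'_adjMatrix e₁ e₂ _).trans ?_), fun h => ?_⟩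
    · rw [Sum.elim_comp_inr, Sum.elim_comp_inl, hf, hg]
      funext x
      rcases x with S | T <;> rfl
    · rcases hne with h0 | h0
      · exact h0 (funext fun S => congrFun h (Sum.inl S))
      · exact h0 (funext fun T => congrFun h (Sum.inr T))

theorem disjOp_one {e e' : ℕ} (hd : d = e + e') :
    disjOp F d e e' 1 = fun _ => (Nat.card F : ℝ) ^ (e * e') := by
  have h := disjOp_restrictDim_above hd (⊥ : Submodule F (Fin d → F))
  rw [finrank_bot, Nat.sub_zero] at h
  have h1 : restrictDim F d e (above ⊥) = 1 := by
    funext S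
    simp [restrictDim_apply, above]
  rw [h1] at h
  rw [h]
  funext T
  simp [restrictDim_apply, avoiding]

/-- Double count the edges: every vertex on either side has degree `q ^ (e * e')`. -/
theorem card_subspaceOfDim_eq {e e' : ℕ} (hd : d = e + e') :
    Fintype.card (SubspaceOfDim F d e) = Fintype.card (SubspaceOfDim F d e') := by
  classical
  have h : ∑ T, disjOp F d e e' 1 T = ∑ S, disjOp F d e' e 1 S := by
    simp only [disjOp_apply]
    rw [Finset.sum_comm]
    simp only [inf_comm, Pi.one_apply]
  rw [disjOp_one hd, disjOp_one (show d = e' + e by omega), Finset.sum_const, Finset.sum_const,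
    nsmul_eq_mul, nsmul_eq_mul, mul_comm e' e, Finset.card_univ, Finset.card_univ] at h
  have hq : (Nat.card F : ℝ) ^ (e * e') ≠ 0 := pow_ne_zero _ (Nat.cast_ne_zero.2 Nat.card_pos.ne')
  exact_mod_cast (mul_right_cancel₀ hq h).symm

variable {e₁ e₂ : ℕ}

/-- Take the least `j` with `g ∈ U_{j+1}`: then `(t - λ_j ^ 2) • g ∈ U_j`, while `g ∉ U_j`. -/
theorem exists_eq_ev_sq (hd : d = e₁ + e₂) (he : e₂ ≤ e₁) {g : SubspaceOfDim F d e₂ → ℝ}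
    (hg : g ≠ 0) {t : ℝ} (h : disjOp F d e₁ e₂ (disjOp F d e₂ e₁ g) = t • g) :
    ∃ j ≤ e₂, t = ev (Nat.card F) d e₁ e₂ j ^ 2 := by
  classical
  have hex : ∃ j, g ∈ lowSpanDim F d e₂ (j + 1) := ⟨e₂, by rw [lowSpanDim_succ_self]; trivial⟩
  have hj : Nat.find hex ≤ e₂ := Nat.find_min' hex (by rw [lowSpanDim_succ_self]; trivial)
  have hnot : g ∉ lowSpanDim F d e₂ (Nat.find hex) := by
    rcases hn : Nat.find hex with _ | k
    · simpa [lowSpanDim_zero] using hg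
    · exact Nat.find_min hex (by omega)
  have hmem := disjOp_disjOp_sub_mem (show d = e₂ + e₁ by omega) (Nat.find_spec hex)
  rw [h, ← sub_smul, diagCoeff_mul_diagCoeff (hj.trans he) hj, ← hd] at hmem
  refine ⟨Nat.find hex, hj, ?_⟩
  by_contra hne
  exact hnot ((Submodule.smul_mem_iff _ (sub_ne_zero.2 hne)).1 hmem)

/-- Otherwise `NᵀN - λ_j ^ 2` would embed `U_{j+1}` into the strictly smaller `U_j`. -/
theorem exists_disjOp_disjOp_eq_ev_sq_smul (hd : d = e₁ + e₂) (he : e₂ ≤ e₁) {j : ℕ}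
    (hj : j ≤ e₂) : ∃ g : SubspaceOfDim F d e₂ → ℝ, g ≠ 0 ∧
      disjOp F d e₁ e₂ (disjOp F d e₂ e₁ g) = (ev (Nat.card F) d e₁ e₂ j ^ 2) • g := by
  by_contra! hcon
  have hd' : d = e₂ + e₁ := by omega
  let M := disjOp F d e₁ e₂ ∘ₗ disjOp F d e₂ e₁ -
    (ev (Nat.card F) d e₁ e₂ j ^ 2) • LinearMap.id
  have hM : Function.Injective M := by
    refine (injective_iff_map_eq_zero M).2 fun g hg => ?_
    by_contra h0
    exact hcon g h0 (sub_eq_zero.1 hg)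
  have hle : (lowSpanDim F d e₂ (j + 1)).map M ≤ lowSpanDim F d e₂ j := by
    rintro _ ⟨g, hg, rfl⟩
    have := disjOp_disjOp_sub_mem hd' hg
    rwa [diagCoeff_mul_diagCoeff (hj.trans he) hj, ← hd] at this
  have h1 := Submodule.finrank_mono hle
  rw [← (Submodule.equivMapOfInjective M hM _).finrank_eq] at h1
  exact absurd (Submodule.finrank_lt_finrank_of_lt (lowSpanDim_lt_succ hd' hj (hj.trans he)))
    (not_lt.2 h1)

theorem disjOp_injective (hd : d = e₁ + e₂) (he : e₂ ≤ e₁) :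
    Function.Injective (disjOp F d e₁ e₂) := by
  have hker : ∀ g, disjOp F d e₁ e₂ (disjOp F d e₂ e₁ g) = 0 → g = 0 := by
    intro g hg
    by_contra h0
    obtain ⟨j, _, hj⟩ := exists_eq_ev_sq hd he h0 (hg.trans (zero_smul ℝ g).symm)
    exact (pow_pos (ev_pos Nat.card_pos) 2).ne hj
  have hinj : Function.Injective (disjOp F d e₂ e₁) :=
    (injective_iff_map_eq_zero _).2 fun g hg => hker g (by rw [hg, map_zero])
  have hsurj := (LinearMap.injective_iff_surjective_of_finrank_eq_finrank
    (by simp [card_subspaceOfDim_eq hd])).1 hinj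
  refine (injective_iff_map_eq_zero _).2 fun f hf => ?_
  obtain ⟨g, rfl⟩ := hsurj f
  rw [hker g hf, map_zero]

theorem eigenvalues_graph (hd : d = e₁ + e₂) (he : e₂ ≤ e₁) :
    eigenvalues (graph F d e₁ e₂) =
      {μ : ℝ | ∃ j : ℕ, j ≤ e₂ ∧
        (μ = ev (Nat.card F) d e₁ e₂ j ∨ μ = -ev (Nat.card F) d e₁ e₂ j)} := by
  ext μ
  rw [mem_eigenvalues_graph_iff]
  constructor
  · rintro ⟨f, g, hne, hg, hf⟩
    have hg0 : g ≠ 0 := by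
      rintro rfl
      refine hne.elim (fun h => h ?_) (fun h => h rfl)
      exact (injective_iff_map_eq_zero _).1 (disjOp_injective hd he) f (by rw [hf, smul_zero])
    obtain ⟨j, hj, h⟩ := exists_eq_ev_sq hd he hg0 (t := μ ^ 2)
      (by rw [hg, map_smul, hf, smul_smul, sq])
    exact ⟨j, hj, sq_eq_sq_iff_eq_or_eq_neg.1 h⟩
  · rintro ⟨j, hj, hμ⟩
    have hμ2 : μ ^ 2 = ev (Nat.card F) d e₁ e₂ j ^ 2 := sq_eq_sq_iff_eq_or_eq_neg.2 hμ
    have hμ0 : μ ≠ 0 := by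
      rintro rfl
      exact (pow_pos (ev_pos Nat.card_pos) 2).ne ((zero_pow two_ne_zero).symm.trans hμ2)
    obtain ⟨g, hg0, hg⟩ := exists_disjOp_disjOp_eq_ev_sq_smul (F := F) hd he hj
    -- Only `μ ^ 2` matters for `g`, so both signs of `μ` lift to eigenvectors of the graph.
    refine ⟨μ⁻¹ • disjOp F d e₂ e₁ g, g, Or.inr hg0, ?_, ?_⟩
    · rw [smul_smul, mul_inv_cancel₀ hμ0, one_smul]
    · rw [map_smul, hg, ← hμ2, smul_smul, sq, inv_mul_cancel_left₀ hμ0]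

end Spectrum
end QKneser

theorem mainTheorem2 (F : Type*) [Field F] [Finite F] (q d e₁ e₂ : ℕ)
    (hq : Nat.card F = q) (he₂ : 1 ≤ e₂) (he : e₂ ≤ e₁) (hd : d = e₁ + e₂) :
    QKneser.eigenvalues (QKneser.graph F d e₁ e₂) =
        {μ : ℝ | ∃ j : ℕ, j ≤ e₂ ∧ (μ = QKneser.ev q d e₁ e₂ j ∨ μ = -QKneser.ev q d e₁ e₂ j)} ∧
      (∀ i j : ℕ, i < j → j ≤ e₂ → QKneser.ev q d e₁ e₂ j < QKneser.ev q d e₁ e₂ i) ∧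
      -QKneser.ev q d e₁ e₂ e₂ < QKneser.ev q d e₁ e₂ e₂ ∧
      (∀ i j : ℕ, i < j → j ≤ e₂ → -QKneser.ev q d e₁ e₂ i < -QKneser.ev q d e₁ e₂ j) ∧
      IsGreatest (QKneser.eigenvalues (QKneser.graph F d e₁ e₂)) ((q : ℝ) ^ (e₁ * e₂)) ∧
      IsGreatest (QKneser.eigenvalues (QKneser.graph F d e₁ e₂) \ {(q : ℝ) ^ (e₁ * e₂)})
        ((q : ℝ) ^ ((e₁ : ℝ) * (e₂ : ℝ) - (d : ℝ) / 2)) := by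
  subst hq
  have hlt : ∀ i j : ℕ, i < j → j ≤ e₂ →
      QKneser.ev (Nat.card F) d e₁ e₂ j < QKneser.ev (Nat.card F) d e₁ e₂ i :=
    fun i j hij hj => QKneser.ev_lt_ev Finite.one_lt_card hij (by omega)
  have hpos : ∀ j, 0 < QKneser.ev (Nat.card F) d e₁ e₂ j := fun j =>
    QKneser.ev_pos Nat.card_pos
  have hle : ∀ i j : ℕ, i ≤ j → j ≤ e₂ →
      QKneser.ev (Nat.card F) d e₁ e₂ j ≤ QKneser.ev (Nat.card F) d e₁ e₂ i := fun i j hij hj =>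
    hij.eq_or_lt.elim (fun h => h ▸ le_rfl) (fun h => (hlt i j h hj).le)
  have h0 : (Nat.card F : ℝ) ^ (e₁ * e₂) = QKneser.ev (Nat.card F) d e₁ e₂ 0 := by
    rw [QKneser.ev, ← Real.rpow_natCast]
    congr 1
    simp [QKneser.m]
  have h1 : (Nat.card F : ℝ) ^ ((e₁ : ℝ) * (e₂ : ℝ) - (d : ℝ) / 2) =
      QKneser.ev (Nat.card F) d e₁ e₂ 1 := by
    rw [QKneser.ev]
    congr 1
    simp [QKneser.m]
  have hspec := QKneser.eigenvalues_graph (F := F) hd he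
  refine ⟨hspec, hlt, neg_lt_self (hpos e₂), fun i j hij hj => neg_lt_neg (hlt i j hij hj), ?_, ?_⟩
  · rw [hspec, h0]
    refine ⟨⟨0, Nat.zero_le _, Or.inl rfl⟩, ?_⟩
    rintro μ ⟨j, hj, rfl | rfl⟩
    · exact hle 0 j (Nat.zero_le j) hj
    · exact (neg_lt_zero.2 (hpos j)).le.trans (hpos 0).le
  · rw [hspec, h0, h1]
    refine ⟨⟨⟨1, he₂, Or.inl rfl⟩, (hlt 0 1 one_pos he₂).ne⟩, ?_⟩
    rintro μ ⟨⟨j, hj, rfl | rfl⟩, hne⟩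
    · refine hle 1 j (Nat.one_le_iff_ne_zero.2 ?_) hj
      rintro rfl
      exact hne rfl
    · exact (neg_lt_zero.2 (hpos j)).le.trans (hpos 1).le
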